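/- For $n\in\mathbb{Z}_{\ge 1}$ and $q\in\mathbb{R}$ let $\mathrm{MK}(q)$ be the unweighted minimum knapsack problem \[ \min\ |\mathbf{x}| \quad\text{s.t.}\quad |\mathbf{x}|\ge q,\quad \mathbf{x}\in\{0,1\}^n, \qquad\text{where } |\mathbf{x}|=\sum_{i=1}^n x_i . \] For $d\in\mathbb{Z}_{\ge 0}$, the degree-$d$ SOS program of $\mathrm{MK}(q)$ asks for the maximum of those $\lambda\in\mathbb{R}$ for which there exist sums of squares of polynomials $s_0,s_1\in\mathbb{R}[x_1,\dots,x_n]$ with $\deg(s_0)\le 2d+2$, $\deg(s_1)\le 2d$ and \[ |\mathbf{x}|-\lambda = s_0(\mathbf{x})+s_1(\mathbf{x})\,(|\mathbf{x}|-q)\qquad\text{for all }\mathbf{x}\in\{0,1\}^n . \] The program is exact if this maximum is attained and equals the optimal value of $\mathrm{MK}(q)$ (which is $\lceil q\rceil$ for $0\le q\le n$). The SOS rank of $\mathrm{MK}(q)$ is the smallest $d\in\mathbb{Z}_{\ge 0}$ for which the degree-$d$ SOS program is exact. **Theorem.** Let $\lfloor n/2\rfloor<q<n$ with fractional part $\widehat{q}=q-\lfloor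 q\rfloor\neq 0$. Then the SOS rank of $\mathrm{MK}(q)$ is $O(n-\lfloor q\rfloor)$. That is, there is an absolute constant $C>0$, independent of $n$ and $q$, such that for all such $n$ and $q$ the SOS rank of $\mathrm{MK}(q)$ is finite and at most $C\,(n-\lfloor q\rfloor)$. -/

import Mathlib

/-- The Boolean hypercube `{0,1}ⁿ`, as a set of real points. -/
def booleanCube (n : ℕ) : Set (Fin n → ℝ) :=
  {x | ∀ i, x i = 0 ∨ x i = 1}

/-- The linear polynomial `|x| = x₁ + ⋯ + xₙ` (the Hamming weight on the hypercube). -/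
noncomputable def weightPoly (n : ℕ) : MvPolynomial (Fin n) ℝ :=
  ∑ i, MvPolynomial.X i

/-- The feasible set of the unweighted minimum knapsack problem `MK(q)`:
the points of `{0,1}ⁿ` with `|x| ≥ q`. -/
def mkFeasible (n : ℕ) (q : ℝ) : Set (Fin n → ℝ) :=
  {x | x ∈ booleanCube n ∧ q ≤ ∑ i, x i}

/-- `v` is the optimal value of `MK(q)`: the minimum of `|x|` over the feasible set. -/
def IsMKOptimum (n : ℕ) (q v : ℝ) : Prop :=
  IsLeast ((fun x : Fin n → ℝ => ∑ i, x i) '' mkFeasible n q) v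

/-- The values `l` that are feasible for the degree-`d` SOS program of `MK(q)`: there are
sums of squares of polynomials `s₀`, `s₁`, of degree at most `2d + 2` and `2d` respectively, with
`|x| - l = s₀(x) + s₁(x) (|x| - q)` on `{0,1}ⁿ`. -/
def mkSOSValues (n : ℕ) (q : ℝ) (d : ℕ) : Set ℝ :=
  {l | ∃ s₀ s₁ : MvPolynomial (Fin n) ℝ,
    IsSumSq s₀ ∧ IsSumSq s₁ ∧
    s₀.totalDegree ≤ 2 * d + 2 ∧ s₁.totalDegree ≤ 2 * d ∧
    ∀ x ∈ booleanCube n,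
      MvPolynomial.eval x (weightPoly n) - l =
        MvPolynomial.eval x s₀ +
          MvPolynomial.eval x s₁ * (MvPolynomial.eval x (weightPoly n) - q)}

/-- The degree-`d` SOS program of `MK(q)` is exact: its maximum is attained and equals the
optimal value of `MK(q)`. (Meant for feasible instances, that is, for `q ≤ n`.) -/
def MKSOSExact (n : ℕ) (q : ℝ) (d : ℕ) : Prop :=
  ∃ v : ℝ, IsMKOptimum n q v ∧ IsGreatest (mkSOSValues n q d) v

/-- The SOS rank of `MK(q)`: the smallest `d` for which the degree-`d` SOS program is exact
(`⊤` if there is none). -/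
noncomputable def mkSOSRank (n : ℕ) (q : ℝ) : ℕ∞ :=
  sInf ((fun d : ℕ => (d : ℕ∞)) '' {d | MKSOSExact n q d})

open Finset

/-! Let `u` count the zeros of `x`, `m = n - ⌊q⌋` and `θ = fract q`. With optimum `⌊q⌋ + 1`, the
certificate must read `m - 1 - u = f + g * (m - θ - u)`, with `f`, `g` sums of squares on the cube.
Interpolation gives `p` of degree `< m` such that `g = p²`, `f = 0` works for `u < m`. For general
`u` the error is a combination of the binomials `u.choose k`, `m ≤ k < 2m`. These are sums of
squares on the cube, but their coefficients `a k` may be negative. Adding `c * u.choose k` to `g`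
adds `c * (u - m + θ) * u.choose k = c * (k - m + θ) * u.choose k + c * (k + 1) * u.choose (k + 1)`
to `f`. As `k - m + θ ≥ θ > 0`, `c = |a k| / θ` repairs the sign. All degrees are linear in `m`. -/

/-- The number of coordinates of `x` that vanish. -/
noncomputable def zeroCount {n : ℕ} (x : Fin n → ℝ) : ℕ :=
  #{i | x i = 0}

theorem zeroCount_le {n : ℕ} (x : Fin n → ℝ) : zeroCount x ≤ n := by
  simpa [zeroCount] using card_filter_le (univ : Finset (Fin n)) (fun i => x i = 0)

theorem sum_one_sub_eq_zeroCount {n : ℕ} {x : Fin n → ℝ} (hx : x ∈ booleanCube n) :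
    ∑ i, (1 - x i) = zeroCount x := by
  rw [zeroCount, card_filter, Nat.cast_sum]
  refine sum_congr rfl fun i _ => ?_
  rcases hx i with h | h <;> simp [h]

theorem sum_eq_sub_zeroCount {n : ℕ} {x : Fin n → ℝ} (hx : x ∈ booleanCube n) :
    ∑ i, x i = n - zeroCount x := by
  have h := sum_one_sub_eq_zeroCount hx
  simp only [sum_sub_distrib, sum_const, card_univ, Fintype.card_fin, nsmul_eq_mul, mul_one] at h
  linarith

/-! ### Sums of squares as functions of the number of zeros -/

/-- On the cube, the function `f` of the number of zeros is a sum of squares of polynomials,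
of degree at most `D`. -/
def IsCubeSumSq (n D : ℕ) (f : ℕ → ℝ) : Prop :=
  ∃ s : MvPolynomial (Fin n) ℝ, IsSumSq s ∧ s.totalDegree ≤ D ∧
    ∀ x ∈ booleanCube n, MvPolynomial.eval x s = f (zeroCount x)

namespace IsCubeSumSq

variable {n D E : ℕ} {f g : ℕ → ℝ}

theorem mono (hf : IsCubeSumSq n D f) (h : D ≤ E) : IsCubeSumSq n E f := by
  obtain ⟨s, hs, hd, he⟩ := hf
  exact ⟨s, hs, hd.trans h, he⟩

theorem add (hf : IsCubeSumSq n D f) (hg : IsCubeSumSq n D g) :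
    IsCubeSumSq n D (fun u => f u + g u) := by
  obtain ⟨s, hs, hsd, hse⟩ := hf
  obtain ⟨t, ht, htd, hte⟩ := hg
  refine ⟨s + t, hs.add ht, (MvPolynomial.totalDegree_add _ _).trans (max_le hsd htd), ?_⟩
  intro x hx
  rw [map_add, hse x hx, hte x hx]

theorem const_mul {c : ℝ} (hc : 0 ≤ c) (hf : IsCubeSumSq n D f) :
    IsCubeSumSq n D (fun u => c * f u) := by
  obtain ⟨s, hs, hsd, hse⟩ := hf
  refine ⟨MvPolynomial.C c * s, IsSumSq.mul ?_ hs, ?_, ?_⟩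
  · rw [← Real.mul_self_sqrt hc, map_mul]
    exact IsSumSq.mul_self _
  · refine (MvPolynomial.totalDegree_mul _ _).trans ?_
    simpa using hsd
  · intro x hx
    rw [map_mul, MvPolynomial.eval_C, hse x hx]

theorem sum {ι : Type*} {I : Finset ι} {F : ι → ℕ → ℝ} (h : ∀ i ∈ I, IsCubeSumSq n D (F i)) :
    IsCubeSumSq n D (fun u => ∑ i ∈ I, F i u) := by
  classical
  induction I using Finset.induction_on with
  | empty => exact ⟨0, IsSumSq.zero, by simp, by simp⟩
  | insert i I hi ih =>
    simp only [sum_insert hi]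
    exact (h i (mem_insert_self i I)).add (ih fun j hj => h j (mem_insert_of_mem hj))

theorem totalDegree_one_sub_X_le (i : Fin n) :
    (1 - MvPolynomial.X i : MvPolynomial (Fin n) ℝ).totalDegree ≤ 1 := by
  refine (MvPolynomial.totalDegree_sub _ _).trans ?_
  simp

/-- On the cube, `∏ i ∈ S, (1 - x i)` is the 0/1 indicator that `x` vanishes on `S`, so it equals
its square; summing over `k`-sets `S` counts the `k`-subsets of the zero set. -/
theorem choose (n k : ℕ) : IsCubeSumSq n (2 * k) (fun u => (u.choose k : ℝ)) := by
  classical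
  refine ⟨∑ S ∈ powersetCard k univ,
    (∏ i ∈ S, (1 - MvPolynomial.X i)) * ∏ i ∈ S, (1 - MvPolynomial.X i),
    IsSumSq.sum_mul_self _ _, ?_, ?_⟩
  · refine MvPolynomial.totalDegree_finsetSum_le fun S hS => ?_
    have hP : (∏ i ∈ S, (1 - MvPolynomial.X i) : MvPolynomial (Fin n) ℝ).totalDegree ≤ k := by
      refine (MvPolynomial.totalDegree_finsetProd _ _).trans ?_
      refine (sum_le_card_nsmul _ _ 1 fun i _ => totalDegree_one_sub_X_le i).trans ?_
      simp [(mem_powersetCard.mp hS).2]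
    refine (MvPolynomial.totalDegree_mul _ _).trans ?_
    lia
  · intro x hx
    have hS : ∀ S : Finset (Fin n), (∏ i ∈ S, (1 - x i)) * ∏ i ∈ S, (1 - x i) =
        if S ⊆ ({i | x i = 0} : Finset (Fin n)) then 1 else 0 := by
      intro S
      split_ifs with h
      · have : ∏ i ∈ S, (1 - x i) = 1 := prod_eq_one fun i hi => by
          have := h hi
          simp only [mem_filter, mem_univ, true_and] at this
          simp [this]
        simp [this]
      · obtain ⟨i, hi, hix⟩ := not_subset.mp h
        have : ∏ i ∈ S, (1 - x i) = 0 := prod_eq_zero hi <| by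
          rcases hx i with h0 | h1
          · simp [h0] at hix
          · simp [h1]
        simp [this]
    have hfilter : ({S ∈ powersetCard k (univ : Finset (Fin n)) | S ⊆ ({i | x i = 0} : Finset (Fin n))}) =
        powersetCard k ({i | x i = 0} : Finset (Fin n)) := by
      ext S
      rw [mem_filter, mem_powersetCard, mem_powersetCard]
      exact ⟨fun h => ⟨h.2, h.1.2⟩, fun h => ⟨⟨subset_univ S, h.2⟩, h.1⟩⟩
    simp only [map_sum, map_mul, map_prod, map_sub, map_one, MvPolynomial.eval_X, hS]
    rw [sum_boole, hfilter, card_powersetCard, zeroCount]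

theorem eval_mul_self (n : ℕ) (p : Polynomial ℝ) :
    IsCubeSumSq n (2 * p.natDegree) (fun u => p.eval (u : ℝ) * p.eval (u : ℝ)) := by
  set U : MvPolynomial (Fin n) ℝ := ∑ i, (1 - MvPolynomial.X i)
  have hU : U.totalDegree ≤ 1 :=
    MvPolynomial.totalDegree_finsetSum_le fun i _ => totalDegree_one_sub_X_le i
  have hp : (Polynomial.aeval U p).totalDegree ≤ p.natDegree := by
    rw [Polynomial.aeval_eq_sum_range]
    refine MvPolynomial.totalDegree_finsetSum_le fun i hi => ?_
    refine (MvPolynomial.totalDegree_smul_le _ _).trans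
      ((MvPolynomial.totalDegree_pow _ _).trans ?_)
    have := mem_range.mp hi
    nlinarith
  refine ⟨Polynomial.aeval U p * Polynomial.aeval U p, IsSumSq.mul_self _, ?_, ?_⟩
  · refine (MvPolynomial.totalDegree_mul _ _).trans ?_
    lia
  · intro x hx
    have : MvPolynomial.eval x (Polynomial.aeval U p) = p.eval (zeroCount x : ℝ) := by
      rw [← sum_one_sub_eq_zeroCount hx, Polynomial.aeval_def, Polynomial.hom_eval₂,
        Polynomial.eval]
      congr 1
      · ext r
        simp
      · simp [U]
    rw [map_mul, this]

end IsCubeSumSq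

/-! ### Univariate interpolation and the certificate -/

/-- A polynomial of degree `< N` that vanishes at `0, …, m - 1` is, on the natural numbers, a linear
combination of the binomial coefficients `u.choose k` with `m ≤ k < N`. -/
theorem Polynomial.exists_eval_natCast_eq_sum_choose {R : Polynomial ℝ} {m N : ℕ}
    (hdeg : R.natDegree < N) (hR : ∀ i < m, R.eval (i : ℝ) = 0) :
    ∃ a : ℕ → ℝ, ∀ u : ℕ, R.eval (u : ℝ) = ∑ k ∈ Ico m N, a k * u.choose k := by
  -- Newton's forward-difference coefficients: the `k`-th involves only the values at `0, …, k`,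
  -- hence vanishes for `k < m`.
  refine ⟨fun k => (fwdDiff 1)^[k] R.eval 0, fun u => ?_⟩
  have hlow : ∀ k < m, (fwdDiff 1)^[k] R.eval 0 = 0 := by
    intro k hk
    rw [fwdDiff_iter_eq_sum_shift]
    refine sum_eq_zero fun i hi => ?_
    have := hR i (by have := mem_range.mp hi; lia)
    simp [this]
  have hhigh : ∀ k, N ≤ k → (fwdDiff 1)^[k] R.eval 0 = 0 := by
    intro k hk
    rw [Polynomial.fwdDiff_iter_eq_zero_of_degree_lt (by lia)]
    rfl
  have hnewton := shift_eq_sum_fwdDiff_iter (1 : ℝ) R.eval u 0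
  simp only [nsmul_eq_mul, mul_one, zero_add] at hnewton
  rw [hnewton]
  have h1 : ∑ k ∈ range (u + 1), (u.choose k : ℝ) * (fwdDiff 1)^[k] R.eval 0 =
      ∑ k ∈ range (u + 1 + N), (u.choose k : ℝ) * (fwdDiff 1)^[k] R.eval 0 := by
    refine sum_subset (range_mono (by lia)) fun k _ hk => ?_
    rw [Nat.choose_eq_zero_of_lt (by simpa using hk)]
    simp
  have h2 : ∑ k ∈ Ico m N, (u.choose k : ℝ) * (fwdDiff 1)^[k] R.eval 0 =
      ∑ k ∈ range (u + 1 + N), (u.choose k : ℝ) * (fwdDiff 1)^[k] R.eval 0 := by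
    refine sum_subset (fun k hk => ?_) fun k _ hk => ?_
    · have := mem_Ico.mp hk
      exact mem_range.mpr (by lia)
    · rw [mem_Ico, not_and_or, not_le, not_lt] at hk
      rcases hk with h | h
      · rw [hlow k h, mul_zero]
      · rw [hhigh k h, mul_zero]
  rw [h1, ← h2]
  exact sum_congr rfl fun k _ => mul_comm _ _

theorem Nat.cast_succ_mul_choose_succ (u k : ℕ) :
    ((k : ℝ) + 1) * u.choose (k + 1) = ((u : ℝ) - k) * u.choose k := by
  rcases lt_or_ge u k with h | h
  · simp [Nat.choose_eq_zero_of_lt h, Nat.choose_eq_zero_of_lt (h.trans (Nat.lt_succ_self k))]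
  · have := Nat.choose_succ_right_eq u k
    rw [← Nat.cast_sub h]
    exact_mod_cast (by lia : (k + 1) * u.choose (k + 1) = (u - k) * u.choose k)

/-- A polynomial of degree `< m` whose square solves `m - 1 - u = p(u)² (m - θ - u)` at
`u = 0, …, m - 1`. -/
theorem exists_polynomial_mul_self_interpolating {m : ℕ} (hm : 0 < m) {θ : ℝ} (hθ : θ < 1) :
    ∃ p : Polynomial ℝ, p.natDegree < m ∧ ∀ i < m,
      p.eval (i : ℝ) * p.eval (i : ℝ) * ((i : ℝ) - m + θ) = (i : ℝ) - m + 1 := by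
  -- For `i ≤ m - 1` the numerator is nonnegative and, since `θ < 1`, the denominator is positive.
  set v : ℕ → ℝ := fun i => √(((m : ℝ) - 1 - i) / (m - θ - i))
  have hinj : Set.InjOn (fun i : ℕ => (i : ℝ)) (range m : Set ℕ) := Nat.cast_injective.injOn
  refine ⟨Lagrange.interpolate (range m) (fun i : ℕ => (i : ℝ)) v, ?_, fun i hi => ?_⟩
  · have h := Lagrange.degree_interpolate_lt v hinj
    rw [card_range] at h
    rcases eq_or_ne (Lagrange.interpolate (range m) (fun i : ℕ => (i : ℝ)) v) 0 with hz | hz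
    · simpa [hz] using hm
    · exact (Polynomial.natDegree_lt_iff_degree_lt hz).mpr h
  · have h := Lagrange.eval_interpolate_at_node v hinj (mem_range.mpr hi)
    have hi' : (i : ℝ) + 1 ≤ m := by exact_mod_cast hi
    have hpos : 0 < (m : ℝ) - θ - i := by linarith
    rw [h, Real.mul_self_sqrt (div_nonneg (by linarith) hpos.le)]
    field_simp
    ring

/-- The certificate, as an identity between functions of the number of zeros. -/
theorem exists_isCubeSumSq_certificate (n : ℕ) {m : ℕ} (hm : 0 < m) {θ : ℝ} (h0 : 0 < θ)
    (h1 : θ < 1) :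
    ∃ f g : ℕ → ℝ, IsCubeSumSq n (4 * m) f ∧ IsCubeSumSq n (4 * m - 2) g ∧
      ∀ u : ℕ, (m : ℝ) - 1 - u = f u + g u * (m - θ - u) := by
  obtain ⟨p, hpd, hp⟩ := exists_polynomial_mul_self_interpolating hm h1
  set R : Polynomial ℝ := p * p * (Polynomial.X - Polynomial.C (m - θ)) -
    (Polynomial.X - Polynomial.C ((m : ℝ) - 1)) with hRdef
  have hReval : ∀ t : ℝ, R.eval t = p.eval t * p.eval t * (t - m + θ) - (t - m + 1) := by
    intro t
    simp only [hRdef, Polynomial.eval_sub, Polynomial.eval_mul, Polynomial.eval_X,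
      Polynomial.eval_C]
    ring
  have hRdeg : R.natDegree < 2 * m := by
    refine (Polynomial.natDegree_sub_le _ _).trans_lt (max_lt ?_ ?_)
    · refine Polynomial.natDegree_mul_le.trans_lt ?_
      rw [Polynomial.natDegree_X_sub_C]
      have := Polynomial.natDegree_mul_le (p := p) (q := p)
      lia
    · rw [Polynomial.natDegree_X_sub_C]
      lia
  obtain ⟨a, ha⟩ := Polynomial.exists_eval_natCast_eq_sum_choose (m := m) hRdeg fun i hi => by
    rw [hReval, hp i hi, sub_self]
  have hc : ∀ k, 0 ≤ |a k| / θ := fun k => div_nonneg (abs_nonneg _) h0.le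
  refine ⟨fun u => ∑ k ∈ Ico m (2 * m), ((a k + |a k| / θ * (k - m + θ)) * u.choose k +
      |a k| / θ * (k + 1) * u.choose (k + 1)),
    fun u => p.eval (u : ℝ) * p.eval (u : ℝ) +
      ∑ k ∈ Ico m (2 * m), |a k| / θ * u.choose k, ?_, ?_, ?_⟩
  · refine IsCubeSumSq.sum fun k hk => ?_
    obtain ⟨hmk, hkm⟩ := mem_Ico.mp hk
    have hmk' : (m : ℝ) ≤ k := by exact_mod_cast hmk
    refine IsCubeSumSq.add ?_ ?_
    · refine ((IsCubeSumSq.choose n k).mono (by lia)).const_mul ?_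
      -- Since `k ≥ m`, the coefficient is at least `a k + |a k| ≥ 0`.
      have hcancel : |a k| / θ * θ = |a k| := div_mul_cancel₀ _ h0.ne'
      have := mul_nonneg (hc k) (sub_nonneg.mpr hmk')
      have := neg_abs_le (a k)
      linarith
    · exact ((IsCubeSumSq.choose n (k + 1)).mono (by lia)).const_mul
        (mul_nonneg (hc k) (by positivity))
  · refine IsCubeSumSq.add ((IsCubeSumSq.eval_mul_self n p).mono (by lia)) ?_
    refine IsCubeSumSq.sum fun k hk => ?_
    have := mem_Ico.mp hk
    exact ((IsCubeSumSq.choose n k).mono (by lia)).const_mul (hc k)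
  · intro u
    have hsum : ∑ k ∈ Ico m (2 * m), ((a k + |a k| / θ * (k - m + θ)) * u.choose k +
        |a k| / θ * (k + 1) * u.choose (k + 1)) =
        ∑ k ∈ Ico m (2 * m), a k * u.choose k +
          (∑ k ∈ Ico m (2 * m), |a k| / θ * u.choose k) * (u - m + θ) := by
      rw [sum_mul, ← sum_add_distrib]
      refine sum_congr rfl fun k _ => ?_
      rw [mul_assoc _ ((k : ℝ) + 1), Nat.cast_succ_mul_choose_succ]
      ring
    simp only [hsum, ← ha u, hReval]
    ring

/-! ### Optimal value, exactness and rank -/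

theorem eval_weightPoly {n : ℕ} (x : Fin n → ℝ) :
    MvPolynomial.eval x (weightPoly n) = ∑ i, x i := by
  simp [weightPoly]

theorem isMKOptimum_floor_add_one {n : ℕ} {q : ℝ} (hq : 0 ≤ q) (hqn : q < n)
    (hfract : Int.fract q ≠ 0) : IsMKOptimum n q (⌊q⌋ + 1) := by
  classical
  lift ⌊q⌋ to ℕ using Int.floor_nonneg.mpr hq with k hk
  have hfl : ((k : ℤ) : ℝ) + Int.fract q = q := by rw [hk]; exact Int.floor_add_fract q
  have hf0 := lt_of_le_of_ne (Int.fract_nonneg q) hfract.symm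
  have hf1 := Int.fract_lt_one q
  rw [Int.cast_natCast] at hfl ⊢
  have hkn : k < n := by
    have : (k : ℝ) < n := by linarith
    exact_mod_cast this
  refine ⟨?_, ?_⟩
  · have hsum : ∑ i : Fin n, (if (i : ℕ) < k + 1 then (1 : ℝ) else 0) = k + 1 := by
      rw [sum_boole, Fin.card_filter_val_lt, min_eq_right (by lia)]
      push_cast
      rfl
    refine ⟨fun i => if (i : ℕ) < k + 1 then 1 else 0, ⟨fun i => ?_, ?_⟩, hsum⟩
    · by_cases h : (i : ℕ) < k + 1 <;> simp [h]
    · rw [hsum]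
      linarith
  · rintro _ ⟨x, ⟨hx, hqx⟩, rfl⟩
    simp only
    rw [sum_eq_sub_zeroCount hx, ← Nat.cast_sub (zeroCount_le x)] at hqx ⊢
    have : (k : ℝ) < (n - zeroCount x : ℕ) := by linarith
    exact_mod_cast this

theorem le_of_mem_mkSOSValues {n : ℕ} {q v l : ℝ} {d : ℕ} (hv : IsMKOptimum n q v)
    (hl : l ∈ mkSOSValues n q d) : l ≤ v := by
  obtain ⟨x, ⟨hx, hqx⟩, rfl⟩ := hv.1
  obtain ⟨s₀, s₁, h₀, h₁, -, -, h⟩ := hl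
  have heval : ∀ {s : MvPolynomial (Fin n) ℝ}, IsSumSq s → 0 ≤ MvPolynomial.eval x s := by
    intro s hs
    induction hs with
    | zero => simp
    | sq_add a _ ih =>
      rw [map_add, map_mul]
      exact add_nonneg (mul_self_nonneg _) ih
  have hx' := h x hx
  rw [eval_weightPoly] at hx'
  have := mul_nonneg (heval h₁) (sub_nonneg.mpr hqx)
  have := heval h₀
  simp only
  linarith

theorem mkSOSExact_two_mul_sub_one {n m : ℕ} {q : ℝ} (hq : 0 ≤ q) (hqn : q < n)
    (hfract : Int.fract q ≠ 0) (hm : (m : ℝ) = n - ⌊q⌋) : MKSOSExact n q (2 * m - 1) := by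
  have hv := isMKOptimum_floor_add_one hq hqn hfract
  have hqfl := Int.floor_add_fract q
  have hm0 : 0 < m := by
    have : (0 : ℝ) < m := by
      have := Int.floor_le q
      linarith
    exact_mod_cast this
  refine ⟨_, hv, ?_, fun l hl => le_of_mem_mkSOSValues hv hl⟩
  obtain ⟨f, g, ⟨s₀, h₀, hd₀, he₀⟩, ⟨s₁, h₁, hd₁, he₁⟩, hfg⟩ := exists_isCubeSumSq_certificate n hm0
    (lt_of_le_of_ne (Int.fract_nonneg q) hfract.symm) (Int.fract_lt_one q)
  -- With `d = 2m - 1` and `m > 0`, the bounds `2d + 2` and `2d` are exactly `4m` and `4m - 2`.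
  refine ⟨s₀, s₁, h₀, h₁, by lia, by lia, fun x hx => ?_⟩
  rw [he₀ x hx, he₁ x hx, eval_weightPoly, sum_eq_sub_zeroCount hx]
  have h := hfg (zeroCount x)
  have h2 : (n : ℝ) - zeroCount x - q = m - Int.fract q - zeroCount x := by linarith
  rw [h2, ← h]
  linarith

theorem exists_mkSOSRank_eq_le {n d : ℕ} {q : ℝ} (h : MKSOSExact n q d) :
    ∃ e : ℕ, mkSOSRank n q = (e : ℕ∞) ∧ e ≤ d := by
  have hle : mkSOSRank n q ≤ (d : ℕ∞) := sInf_le ⟨d, h, rfl⟩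
  obtain ⟨e, he⟩ := ENat.ne_top_iff_exists.mp (ne_top_of_le_ne_top (ENat.natCast_ne_top d) hle)
  refine ⟨e, he.symm, ?_⟩
  rw [← he] at hle
  exact_mod_cast hle

theorem mainTheorem4 :
    ∃ C : ℝ, 0 < C ∧ ∀ (n : ℕ) (q : ℝ),
      (⌊(n : ℝ) / 2⌋ : ℝ) < q → q < (n : ℝ) → Int.fract q ≠ 0 →
        ∃ d : ℕ, mkSOSRank n q = (d : ℕ∞) ∧ (d : ℝ) ≤ C * ((n : ℝ) - (⌊q⌋ : ℝ)) := by
  refine ⟨2, two_pos, fun n q hnq hqn hfract => ?_⟩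
  have hhalf : (0 : ℝ) ≤ ⌊(n : ℝ) / 2⌋ := by
    exact_mod_cast Int.floor_nonneg.mpr (by positivity : (0 : ℝ) ≤ (n : ℝ) / 2)
  have hfloor : ⌊q⌋ ≤ (n : ℤ) := Int.floor_le_iff.mpr (by push_cast; linarith)
  obtain ⟨m, hm⟩ := Int.eq_ofNat_of_zero_le (sub_nonneg.mpr hfloor)
  have hm' : (m : ℝ) = n - ⌊q⌋ := by exact_mod_cast hm.symm
  obtain ⟨d, hd, hle⟩ := exists_mkSOSRank_eq_le
    (mkSOSExact_two_mul_sub_one (hhalf.trans hnq.le) hqn hfract hm')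
  refine ⟨d, hd, ?_⟩
  rw [← hm']
  exact_mod_cast hle.trans (Nat.sub_le _ _)
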